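/- Let $\Delta=\{z\in\mathbb C:|z|<1\}$ and let $0\le\alpha<1$. Let $\mathcal{BS}(\alpha)$ be the class of functions $f$ analytic in $\Delta$ with $f(0)=0$, $f'(0)=1$ and $f(z)\neq 0$ for $0<|z|<1$ for which $$\frac{zf'(z)}{f(z)}-1\prec F_\alpha(z):=\frac{z}{1-\alpha z^2},$$ that is, there is an analytic $w:\Delta\to\Delta$ with $w(0)=0$ and $zf'(z)/f(z)-1=F_\alpha(w(z))$ for all $z\in\Delta$ (the quotient $zf'(z)/f(z)$ being given its limit $1$ at $z=0$). For $a<1<b$ let $$P_{a,b}(z)=1+\frac{b-a}{\pi}\,i\log\left(\frac{1-e^{2\pi i\frac{1-a}{b-a}}z}{1-z}\right)\qquad(z\in\Delta),$$ with the principal logarithm; it maps $\Delta$ conformally onto the strip $a<\operatorname{Re}w<b$. Put $$P_\alpha(z)=P_{\frac{\alpha}{\alpha-1},\,\frac{2-\alpha}{1-\alpha}}(z)=1+\frac{2}{\pi(1-\alpha)}\,i\log\left(\frac{1+z}{1-z}\right),\qquad \widetilde P_\alpha(z)=\int_0^z\frac{P_\alpha(t)-1}{t}\,dt\qquad(z\in\Delta).$$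 If $f\in\mathcal{BS}(\alpha)$ and $0<|z|=r<1$, then $$\min_{|\zeta|=r}\left|\exp\widetilde P_\alpha(\zeta)\right|\le\left|\frac{f(z)}{z}\right|\le\max_{|\zeta|=r}\left|\exp\widetilde P_\alpha(\zeta)\right|.$$ -/

import Mathlib

namespace BoothLemniscate

/-- The open unit disk `Δ` of the complex plane. -/
def unitDisk : Set ℂ := Metric.ball 0 1

/-- The class `𝒜`: functions analytic in `Δ` with `f(z) = z + a₂ z² + ⋯`. Only the values on `Δ`
matter. -/
def ClassA (f : ℂ → ℂ) : Prop :=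
  DifferentiableOn ℂ f unitDisk ∧ f 0 = 0 ∧ deriv f 0 = 1

/-- The class `𝔅`: analytic functions `w` in `Δ` with `w(0) = 0` and `|w| < 1`. -/
def SchwarzClass (w : ℂ → ℂ) : Prop :=
  DifferentiableOn ℂ w unitDisk ∧ w 0 = 0 ∧ ∀ z ∈ unitDisk, ‖w z‖ < 1

/-- Subordination `f ≺ g` in `Δ`. -/
def Subordinate (f g : ℂ → ℂ) : Prop :=
  ∃ w : ℂ → ℂ, SchwarzClass w ∧ ∀ z ∈ unitDisk, f z = g (w z)

/-- `F_α(z) = z / (1 - α z²)`. -/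
noncomputable def boothMap (α : ℝ) (z : ℂ) : ℂ := z / (1 - (α : ℂ) * z ^ 2)

/-- The quotient `z f'(z) / f(z)`, with the value `1` of its analytic extension at `z = 0`
(for `f` in the class `𝒜`). -/
noncomputable def starQuotient (f : ℂ → ℂ) (z : ℂ) : ℂ :=
  if z = 0 then 1 else z * deriv f z / f z

/-- The class `BS(α)`: functions `f ∈ 𝒜` with `z f'(z) / f(z) - 1 ≺ F_α(z)`; for this the quotient
has to be defined, that is, `f` has no zero in `Δ` other than the origin. -/
def ClassBS (α : ℝ) (f : ℂ → ℂ) : Prop :=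
  ClassA f ∧ (∀ z ∈ unitDisk, z ≠ 0 → f z ≠ 0) ∧
    Subordinate (fun z => starQuotient f z - 1) (boothMap α)

/-- The function `P_{a,b}` that maps `Δ` conformally onto the strip `a < Re w < b`
(for `a < 1 < b`), with `P_{a,b}(0) = 1`. The argument of the logarithm then lies in a half-plane
that avoids the non-positive reals, so the principal branch is the intended one. -/
noncomputable def stripMap (a b : ℝ) (z : ℂ) : ℂ :=
  1 + ((b : ℂ) - a) / Real.pi * Complex.I *
    Complex.log
      ((1 - Complex.exp (2 * Real.pi * Complex.I * ((1 - (a : ℂ)) / ((b : ℂ) - a))) * z) / (1 - z))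

/-- The function `P_α`: the strip map for `α / (α - 1) < Re w < (2 - α) / (1 - α)`, the smallest
vertical strip containing the range of `1 + F_α`. -/
noncomputable def boothStrip (α : ℝ) (z : ℂ) : ℂ :=
  stripMap (α / (α - 1)) ((2 - α) / (1 - α)) z

/-- The closed form of `P_α`. -/
theorem boothStrip_eq {α : ℝ} (hα : α < 1) (z : ℂ) :
    boothStrip α z = 1 + 2 / (Real.pi * (1 - (α : ℂ))) * Complex.I *
      Complex.log ((1 + z) / (1 - z)) := by
  have h1 : (1 - (α : ℂ)) ≠ 0 := by
    intro h
    have h' : (1 : ℝ) - α = 0 := by exact_mod_cast h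
    linarith
  have h2 : ((α : ℂ) - 1) ≠ 0 := by
    intro h
    exact h1 (by linear_combination -h)
  have hw : (((2 - α) / (1 - α) : ℝ) : ℂ) - ((α / (α - 1) : ℝ) : ℂ) = 2 / (1 - (α : ℂ)) := by
    push_cast
    field_simp
    ring
  have ha : (1 - ((α / (α - 1) : ℝ) : ℂ)) = 1 / (1 - (α : ℂ)) := by
    push_cast
    field_simp
    ring
  have hr : 1 / (1 - (α : ℂ)) / (2 / (1 - (α : ℂ))) = 1 / 2 := by
    field_simp
  have he : Complex.exp (2 * Real.pi * Complex.I * (1 / 2)) = -1 := by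
    rw [← Complex.exp_pi_mul_I]
    congr 1
    ring
  unfold boothStrip stripMap
  rw [hw, ha, hr, he, div_div, mul_comm (1 - (α : ℂ)) (Real.pi : ℂ), neg_one_mul, sub_neg_eq_add]

/-- `P̃_α(z) = ∫_0^z (P_α(t) - 1) / t dt`, the integral being taken along the segment `t = s z`,
`0 ≤ s ≤ 1`. -/
noncomputable def boothPrimitive (α : ℝ) (z : ℂ) : ℂ :=
  ∫ s in (0 : ℝ)..1, (boothStrip α ((s : ℂ) * z) - 1) / ((s : ℂ) * z) * z

end BoothLemniscate

namespace BoothLemniscate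

open Set MeasureTheory

/-! Both sides are compared, along the radius, with the explicit integral of `majorant`. With `r =
|ζ|`, the real part of the integrand of the primitive is, up to a constant, `-arg((1 + sζ)/(1 - sζ))
/ s`; this argument is at most `2 arctan(sr)` in modulus, with equality for every `s` at `ζ = ±ir`.
So the minimum and maximum are exactly `exp(∓∫ majorant)`. For `f`, `log|f(z)/z|` is the radial
integral of `Re (zf'/f - 1)/s`. Schwarz's lemma gives `|F_α(w(sz))| ≤ sr/(1 - α)`, and concavity of
`arctan` gives `sr ≤ (4/π) arctan(sr)`: the same majorant. The theory of subordination to convex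
maps is thus not needed. -/

theorem one_sub_ne_zero_of_norm_lt_one {w : ℂ} (hw : ‖w‖ < 1) : 1 - w ≠ 0 := by
  intro h
  have : w = 1 := by linear_combination -h
  simp [this] at hw

/-! ### The Cayley map and its argument. -/

theorem re_cayley (w : ℂ) :
    ((1 + w) / (1 - w)).re = (1 - ‖w‖ ^ 2) / Complex.normSq (1 - w) := by
  rw [Complex.div_re, ← Complex.normSq_eq_norm_sq, Complex.normSq_apply w]
  simp only [Complex.add_re, Complex.sub_re, Complex.one_re, Complex.add_im, Complex.sub_im,
    Complex.one_im]
  ring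

theorem im_cayley (w : ℂ) : ((1 + w) / (1 - w)).im = 2 * w.im / Complex.normSq (1 - w) := by
  rw [Complex.div_im]
  simp only [Complex.add_re, Complex.sub_re, Complex.one_re, Complex.add_im, Complex.sub_im,
    Complex.one_im]
  ring

theorem re_cayley_pos {w : ℂ} (hw : ‖w‖ < 1) : 0 < ((1 + w) / (1 - w)).re := by
  have hpos : 0 < 1 - ‖w‖ ^ 2 := by nlinarith [norm_nonneg w]
  have hN := Complex.normSq_pos.2 (one_sub_ne_zero_of_norm_lt_one hw)
  rw [re_cayley]
  positivity

/-- The argument of `(1 + w) / (1 - w)` for `w` in the unit disk. -/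
theorem arg_cayley {w : ℂ} (hw : ‖w‖ < 1) :
    Complex.arg ((1 + w) / (1 - w)) = Real.arctan (2 * w.im / (1 - ‖w‖ ^ 2)) := by
  have hN := Complex.normSq_pos.2 (one_sub_ne_zero_of_norm_lt_one hw)
  have habs := Complex.abs_arg_lt_pi_div_two_iff.2 (Or.inl (re_cayley_pos hw))
  rw [abs_lt] at habs
  rw [← Real.arctan_tan habs.1 habs.2, Complex.tan_arg, re_cayley, im_cayley]
  congr 1
  field_simp

theorem differentiableOn_log_cayley :
    DifferentiableOn ℂ (fun w : ℂ => Complex.log ((1 + w) / (1 - w))) (Metric.ball 0 1) := by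
  intro w hw
  rw [mem_ball_zero_iff] at hw
  have hne := one_sub_ne_zero_of_norm_lt_one hw
  refine DifferentiableAt.differentiableWithinAt
    (DifferentiableAt.clog ?_ (Or.inl (re_cayley_pos hw)))
  fun_prop (disch := assumption)

theorem norm_real_smul_lt {z : ℂ} (hz : ‖z‖ < 1) {s : ℝ} (hs : s ∈ Icc (0 : ℝ) 1) :
    ‖(s : ℂ) * z‖ < 1 := by
  rw [norm_mul, Complex.norm_real, Real.norm_of_nonneg hs.1]
  nlinarith [hs.1, hs.2, norm_nonneg z]

/-- The real part of the integrand of `boothPrimitive`. -/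
noncomputable def reIntegrand (α : ℝ) (ζ : ℂ) (s : ℝ) : ℝ :=
  -(2 / (Real.pi * (1 - α)) *
    (Real.arctan (2 * (s * ζ.im) / (1 - (s * ‖ζ‖) ^ 2)) / s))

/-- The endpoint `s = 0` is allowed because both sides are then divisions by zero, equal to `0`. -/
theorem re_integrand_eq {α : ℝ} (hα : α < 1) {ζ : ℂ} (hζ0 : ζ ≠ 0) (hζ : ‖ζ‖ < 1) {s : ℝ}
    (hs : s ∈ Icc (0 : ℝ) 1) :
    ((boothStrip α ((s : ℂ) * ζ) - 1) / ((s : ℂ) * ζ) * ζ).re = reIntegrand α ζ s := by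
  have hlog := arg_cayley (norm_real_smul_lt hζ hs)
  rw [boothStrip_eq hα, add_sub_cancel_left, reIntegrand]
  have h1 : ∀ L : ℂ, 2 / ((Real.pi : ℂ) * (1 - (α : ℂ))) * Complex.I * L / ((s : ℂ) * ζ) * ζ =
      ((2 / (Real.pi * (1 - α)) / s : ℝ) : ℂ) * (Complex.I * L) := by
    intro L
    push_cast
    rw [div_mul_eq_mul_div, mul_div_mul_right _ _ hζ0]
    ring
  rw [h1, Complex.re_ofReal_mul, Complex.I_mul_re, Complex.log_im, hlog, norm_mul,
    Complex.norm_real, Real.norm_of_nonneg hs.1, Complex.im_ofReal_mul]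
  ring

/-- The singularity at `s = 0` is removable: off it, the integrand is a constant multiple of the
analytic `dslope` of the logarithm. -/
theorem intervalIntegrable_integrand {α : ℝ} (hα : α < 1) {ζ : ℂ} (hζ0 : ζ ≠ 0) (hζ : ‖ζ‖ < 1) :
    IntervalIntegrable
      (fun s : ℝ => (boothStrip α ((s : ℂ) * ζ) - 1) / ((s : ℂ) * ζ) * ζ) volume 0 1 := by
  have hd : DifferentiableOn ℂ (dslope (fun w : ℂ => Complex.log ((1 + w) / (1 - w))) 0)
      (Metric.ball 0 1) :=
    (Complex.differentiableOn_dslope (Metric.ball_mem_nhds 0 one_pos)).2 differentiableOn_log_cayley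
  have hc : ContinuousOn (fun s : ℝ => 2 / ((Real.pi : ℂ) * (1 - (α : ℂ))) * Complex.I *
      dslope (fun w : ℂ => Complex.log ((1 + w) / (1 - w))) 0 ((s : ℂ) * ζ) * ζ) (Icc 0 1) := by
    refine (continuousOn_const.mul (hd.continuousOn.comp (by fun_prop) ?_)).mul continuousOn_const
    intro s hs
    simpa using norm_real_smul_lt hζ hs
  rw [← uIcc_of_le zero_le_one] at hc
  refine hc.intervalIntegrable.congr ?_
  intro s hs
  rw [uIoc_of_le zero_le_one] at hs
  have hs0 : (s : ℂ) * ζ ≠ 0 := mul_ne_zero (by exact_mod_cast hs.1.ne') hζ0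
  simp only
  rw [boothStrip_eq hα, add_sub_cancel_left, dslope_of_ne _ hs0, slope_def_field]
  simp only [add_zero, sub_zero, div_one, Complex.log_one]
  ring

theorem intervalIntegrable_reIntegrand {α : ℝ} (hα : α < 1) {ζ : ℂ} (hζ0 : ζ ≠ 0)
    (hζ : ‖ζ‖ < 1) : IntervalIntegrable (reIntegrand α ζ) volume 0 1 := by
  have h := intervalIntegrable_integrand hα hζ0 hζ
  have h' : IntervalIntegrable
      (fun s : ℝ => ((boothStrip α ((s : ℂ) * ζ) - 1) / ((s : ℂ) * ζ) * ζ).re) volume 0 1 :=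
    ⟨h.1.re, h.2.re⟩
  refine h'.congr ?_
  intro s hs
  rw [uIoc_of_le zero_le_one] at hs
  exact re_integrand_eq hα hζ0 hζ (Ioc_subset_Icc_self hs)

theorem norm_exp_boothPrimitive {α : ℝ} (hα : α < 1) {ζ : ℂ} (hζ0 : ζ ≠ 0) (hζ : ‖ζ‖ < 1) :
    ‖Complex.exp (boothPrimitive α ζ)‖ = Real.exp (∫ s in (0 : ℝ)..1, reIntegrand α ζ s) := by
  rw [Complex.norm_exp, boothPrimitive]
  congr 1
  have h := Complex.reCLM.intervalIntegral_comp_comm (intervalIntegrable_integrand hα hζ0 hζ)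
  simp only [Complex.reCLM_apply] at h
  rw [← h]
  refine intervalIntegral.integral_congr fun s hs => ?_
  rw [uIcc_of_le zero_le_one] at hs
  exact re_integrand_eq hα hζ0 hζ hs

/-- The largest value of `reIntegrand α ζ s` on the circle `‖ζ‖ = r`. -/
noncomputable def majorant (α r s : ℝ) : ℝ :=
  2 / (Real.pi * (1 - α)) * (2 * Real.arctan (s * r) / s)

/-- Uses `|Im ζ| ≤ |ζ|` and `2 arctan x = arctan(2x/(1 - x²))` for `x = s‖ζ‖ < 1`. -/
theorem abs_reIntegrand_le {α : ℝ} (hα : α < 1) {ζ : ℂ} (hζ : ‖ζ‖ < 1) {s : ℝ}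
    (hs : s ∈ Icc (0 : ℝ) 1) : |reIntegrand α ζ s| ≤ majorant α ‖ζ‖ s := by
  have hα' : 0 < 1 - α := sub_pos.2 hα
  have hsr0 : 0 ≤ s * ‖ζ‖ := mul_nonneg hs.1 (norm_nonneg _)
  have hsr1 : s * ‖ζ‖ < 1 := by nlinarith [hs.1, hs.2, norm_nonneg ζ]
  have hden : 0 < 1 - (s * ‖ζ‖) ^ 2 := by nlinarith
  have him := abs_le.1 (Complex.abs_im_le_norm ζ)
  have key : |Real.arctan (2 * (s * ζ.im) / (1 - (s * ‖ζ‖) ^ 2))| ≤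
      2 * Real.arctan (s * ‖ζ‖) := by
    rw [Real.two_mul_arctan (by linarith) hsr1, abs_le, ← Real.arctan_neg, ← neg_div]
    constructor <;> refine Real.arctan_mono ?_ <;> gcongr <;> nlinarith [hs.1]
  rw [reIntegrand, majorant, abs_neg, abs_mul,
    abs_of_nonneg (a := 2 / (Real.pi * (1 - α))) (by positivity), abs_div _ s, abs_of_nonneg hs.1]
  have := hs.1
  gcongr

theorem reIntegrand_neg_I (α : ℝ) {r : ℝ} (hr0 : 0 ≤ r) (hr1 : r < 1) {s : ℝ}
    (hs : s ∈ Icc (0 : ℝ) 1) : reIntegrand α (-(r * Complex.I)) s = majorant α r s := by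
  have hsr0 : 0 ≤ s * r := mul_nonneg hs.1 hr0
  have hsr1 : s * r < 1 := by nlinarith [hs.1, hs.2]
  rw [reIntegrand, majorant, Real.two_mul_arctan (by linarith) hsr1]
  simp [abs_of_nonneg hr0, neg_div, Real.arctan_neg]

theorem reIntegrand_I (α : ℝ) {r : ℝ} (hr0 : 0 ≤ r) (hr1 : r < 1) {s : ℝ}
    (hs : s ∈ Icc (0 : ℝ) 1) : reIntegrand α (r * Complex.I) s = -majorant α r s := by
  have hsr0 : 0 ≤ s * r := mul_nonneg hs.1 hr0
  have hsr1 : s * r < 1 := by nlinarith [hs.1, hs.2]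
  rw [reIntegrand, majorant, Real.two_mul_arctan (by linarith) hsr1]
  simp [abs_of_nonneg hr0]

theorem intervalIntegrable_majorant {α : ℝ} (hα : α < 1) {r : ℝ} (hr0 : 0 < r) (hr1 : r < 1) :
    IntervalIntegrable (majorant α r) volume 0 1 := by
  refine (intervalIntegrable_reIntegrand hα (ζ := -(r * Complex.I)) ?_ ?_).congr ?_
  · simp [hr0.ne']
  · simpa [abs_of_pos hr0] using hr1
  · intro s hs
    rw [uIoc_of_le zero_le_one] at hs
    exact reIntegrand_neg_I α hr0.le hr1 (Ioc_subset_Icc_self hs)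

/-! ### The growth of `f`. -/

/-- The chord of `arctan` over `[0, 1]` lies below its graph. -/
theorem le_arctan_of_mem_Icc {x : ℝ} (hx : x ∈ Icc (0 : ℝ) 1) :
    x ≤ 4 / Real.pi * Real.arctan x := by
  have hconc : ConcaveOn ℝ (Icc (0 : ℝ) 1) Real.arctan := by
    refine AntitoneOn.concaveOn_of_deriv (convex_Icc 0 1) Real.continuous_arctan.continuousOn
      Real.differentiable_arctan.differentiableOn ?_
    rw [interior_Icc, Real.deriv_arctan]
    intro a ha b hb hab
    have := ha.1
    simp only
    gcongr
  have h := hconc.2 (left_mem_Icc.2 zero_le_one) (right_mem_Icc.2 zero_le_one)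
    (sub_nonneg.2 hx.2) hx.1 (by ring)
  simp only [smul_eq_mul, mul_zero, mul_one, zero_add, Real.arctan_zero, Real.arctan_one] at h
  rw [div_mul_eq_mul_div, le_div_iff₀ Real.pi_pos]
  linarith

theorem norm_boothMap_le {α : ℝ} (hα0 : 0 ≤ α) (hα1 : α < 1) {w : ℂ} {ρ : ℝ} (hw : ‖w‖ ≤ ρ)
    (hρ : ρ ≤ 1) : ‖boothMap α w‖ ≤ ρ / (1 - α) := by
  have hα' : 0 < 1 - α := sub_pos.2 hα1
  have hw2 : ‖w‖ ^ 2 ≤ 1 := pow_le_one₀ (norm_nonneg _) (hw.trans hρ)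
  have hden : 1 - α ≤ ‖1 - (α : ℂ) * w ^ 2‖ := by
    have h := norm_sub_norm_le (1 : ℂ) ((α : ℂ) * w ^ 2)
    rw [norm_one, norm_mul, norm_pow, Complex.norm_real, Real.norm_of_nonneg hα0] at h
    nlinarith
  rw [boothMap, norm_div]
  exact div_le_div₀ ((norm_nonneg _).trans hw) hw hα' hden

theorem norm_le_of_schwarzClass {w : ℂ → ℂ} (hw : SchwarzClass w) {z : ℂ} (hz : z ∈ unitDisk) :
    ‖w z‖ ≤ ‖z‖ := by
  obtain ⟨hd, h0, hlt⟩ := hw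
  refine Complex.norm_le_norm_of_mapsTo_ball hd (fun x hx => ?_) h0 (mem_ball_zero_iff.1 hz)
  simpa using (hlt x hx).le

theorem norm_starQuotient_sub_one_div_le {α : ℝ} (hα0 : 0 ≤ α) (hα1 : α < 1) {f : ℂ → ℂ}
    (hf : ClassBS α f) {z : ℂ} (hz : ‖z‖ < 1) {s : ℝ} (hs : s ∈ Ioc (0 : ℝ) 1) :
    ‖(starQuotient f (s * z) - 1) / s‖ ≤ majorant α ‖z‖ s := by
  obtain ⟨-, -, w, hw, hsub⟩ := hf
  have hα' : 0 < 1 - α := sub_pos.2 hα1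
  have hlt := norm_real_smul_lt hz (Ioc_subset_Icc_self hs)
  have hmem : (s : ℂ) * z ∈ unitDisk := mem_ball_zero_iff.2 hlt
  have hnorm : ‖(s : ℂ) * z‖ = s * ‖z‖ := by
    rw [norm_mul, Complex.norm_real, Real.norm_of_nonneg hs.1.le]
  have hle := norm_le_of_schwarzClass hw hmem
  rw [hnorm] at hle hlt
  have hF := norm_boothMap_le hα0 hα1 hle hlt.le
  have hsub' := hsub _ hmem
  simp only at hsub'
  have harc := le_arctan_of_mem_Icc ⟨mul_nonneg hs.1.le (norm_nonneg z), hlt.le⟩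
  have := hs.1
  rw [hsub', norm_div, Complex.norm_real, Real.norm_of_nonneg hs.1.le, majorant]
  calc ‖boothMap α (w (s * z))‖ / s ≤ (s * ‖z‖ / (1 - α)) / s := by gcongr
    _ ≤ (4 / Real.pi * Real.arctan (s * ‖z‖) / (1 - α)) / s := by gcongr
    _ = _ := by field_simp; ring

/-- Working with `log ‖g‖` avoids choosing a branch of `log g`. -/
theorem hasDerivAt_log_norm {g : ℝ → ℂ} {g' : ℂ} {s : ℝ} (hg : HasDerivAt g g' s)
    (h0 : g s ≠ 0) : HasDerivAt (fun t => Real.log ‖g t‖) (g' / g s).re s := by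
  have hsq := (hg.norm_sq.log (by positivity)).const_mul (1 / 2 : ℝ)
  have hfun : (fun t => Real.log ‖g t‖) = fun t => 1 / 2 * Real.log (‖g t‖ ^ 2) := by
    funext t
    rw [Real.log_pow]
    push_cast
    ring
  rw [hfun]
  refine hsq.congr_deriv ?_
  rw [← Complex.normSq_eq_norm_sq, Complex.inner, Complex.div_re]
  simp only [Complex.mul_re, Complex.conj_re, Complex.conj_im]
  have := Complex.normSq_pos.2 h0
  field_simp
  ring

theorem abs_log_norm_div_le {α : ℝ} (hα0 : 0 ≤ α) (hα1 : α < 1) {f : ℂ → ℂ}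
    (hf : ClassBS α f) {z : ℂ} (hz0 : z ≠ 0) (hz : ‖z‖ < 1) :
    |Real.log ‖f z / z‖| ≤ ∫ s in (0 : ℝ)..1, majorant α ‖z‖ s := by
  obtain ⟨⟨hfd, hf0, hf1⟩, hfne, -⟩ := id hf
  have hopen : IsOpen (Metric.ball (0 : ℂ) 1) := Metric.isOpen_ball
  have hgd : DifferentiableOn ℂ (dslope f 0) (Metric.ball 0 1) :=
    (Complex.differentiableOn_dslope (Metric.ball_mem_nhds 0 one_pos)).2 hfd
  have hfg : ∀ x, f x = x * dslope f 0 x := by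
    intro x
    have h := sub_smul_dslope f 0 x
    rw [hf0, sub_zero, sub_zero, smul_eq_mul] at h
    exact h.symm
  have hg0 : dslope f 0 0 = 1 := by rw [dslope_same, hf1]
  have hgne : ∀ x ∈ Metric.ball (0 : ℂ) 1, dslope f 0 x ≠ 0 := by
    intro x hx h
    rcases eq_or_ne x 0 with rfl | hx0
    · rw [hg0] at h
      exact one_ne_zero h
    · exact hfne x hx hx0 (by rw [hfg, h, mul_zero])
  have hmem : ∀ s ∈ Icc (0 : ℝ) 1, (s : ℂ) * z ∈ Metric.ball (0 : ℂ) 1 := fun s hs =>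
    mem_ball_zero_iff.2 (norm_real_smul_lt hz hs)
  have hder : ∀ s ∈ Icc (0 : ℝ) 1,
      HasDerivAt (fun t : ℝ => Real.log ‖dslope f 0 ((t : ℂ) * z)‖)
        (deriv (dslope f 0) ((s : ℂ) * z) * z / dslope f 0 ((s : ℂ) * z)).re s := by
    intro s hs
    refine hasDerivAt_log_norm ?_ (hgne _ (hmem s hs))
    have h1 : HasDerivAt (fun t : ℝ => (t : ℂ) * z) z s := by
      simpa using (Complex.ofRealCLM.hasDerivAt (x := s)).mul_const z
    exact (hgd.differentiableAt (hopen.mem_nhds (hmem s hs))).hasDerivAt.comp s h1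
  have hcont : ContinuousOn (fun t : ℝ => Real.log ‖dslope f 0 ((t : ℂ) * z)‖) (Icc 0 1) :=
    fun s hs => (hder s hs).continuousAt.continuousWithinAt
  have hbound : ∀ s ∈ Ioo (0 : ℝ) 1,
      |(deriv (dslope f 0) ((s : ℂ) * z) * z / dslope f 0 ((s : ℂ) * z)).re| ≤
        majorant α ‖z‖ s := by
    intro s hs
    have hs' := Ioo_subset_Icc_self hs
    have hsC : (s : ℂ) ≠ 0 := by exact_mod_cast hs.1.ne'
    have hx0 : (s : ℂ) * z ≠ 0 := mul_ne_zero hsC hz0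
    have hgx := hgne _ (hmem s hs')
    have hdf : deriv f ((s : ℂ) * z) =
        dslope f 0 ((s : ℂ) * z) + (s : ℂ) * z * deriv (dslope f 0) ((s : ℂ) * z) := by
      have h := (hasDerivAt_id ((s : ℂ) * z)).mul
        (hgd.differentiableAt (hopen.mem_nhds (hmem s hs'))).hasDerivAt
      have hfun : f = id * dslope f 0 := by
        funext x
        exact hfg x
      rw [← hfun] at h
      simpa using h.deriv
    -- Logarithmic differentiation of `f(x) = x g(x)` at `x = sz`, where `g = dslope f 0`.
    have hq : deriv (dslope f 0) ((s : ℂ) * z) * z / dslope f 0 ((s : ℂ) * z) =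
        (starQuotient f (s * z) - 1) / s := by
      rw [starQuotient, if_neg hx0, hdf, hfg ((s : ℂ) * z)]
      field_simp
      ring
    rw [hq]
    exact (Complex.abs_re_le_norm _).trans
      (norm_starQuotient_sub_one_div_le hα0 hα1 hf hz (Ioo_subset_Ioc_self hs))
  have hint := intervalIntegrable_majorant hα1 (norm_pos_iff.2 hz0) hz
  have hintOn : IntegrableOn (majorant α ‖z‖) (Icc 0 1) :=
    (intervalIntegrable_iff_integrableOn_Icc_of_le zero_le_one).1 hint
  have hderiv := fun s (hs : s ∈ Ioo (0 : ℝ) 1) =>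
    (hder s (Ioo_subset_Icc_self hs)).hasDerivWithinAt (s := Ioi s)
  -- Only the bound has to be integrable here, not the derivative itself.
  have hup := intervalIntegral.sub_le_integral_of_hasDeriv_right_of_le zero_le_one hcont hderiv
    hintOn fun s hs => (abs_le.1 (hbound s hs)).2
  have hlow := intervalIntegral.integral_le_sub_of_hasDeriv_right_of_le zero_le_one hcont hderiv
    hintOn.neg fun s hs => (abs_le.1 (hbound s hs)).1
  simp only [Pi.neg_apply, intervalIntegral.integral_neg, Complex.ofReal_one, one_mul,
    Complex.ofReal_zero, zero_mul, hg0, norm_one, Real.log_one, sub_zero] at hup hlow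
  have hgz : f z / z = dslope f 0 z := by rw [hfg z, mul_div_cancel_left₀ _ hz0]
  rw [hgz]
  exact abs_le.2 ⟨hlow, hup⟩

end BoothLemniscate

open BoothLemniscate in
theorem corollary2p2 (α : ℝ) (hα0 : 0 ≤ α) (hα1 : α < 1) (f : ℂ → ℂ)
    (hf : BoothLemniscate.ClassBS α f) (r : ℝ) (hr0 : 0 < r) (hr1 : r < 1) :
    ∃ m M : ℝ,
      IsLeast ((fun ζ : ℂ => ‖Complex.exp (BoothLemniscate.boothPrimitive α ζ)‖) ''
        {ζ : ℂ | ‖ζ‖ = r}) m ∧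
      IsGreatest ((fun ζ : ℂ => ‖Complex.exp (BoothLemniscate.boothPrimitive α ζ)‖) ''
        {ζ : ℂ | ‖ζ‖ = r}) M ∧
      ∀ z : ℂ, ‖z‖ = r → m ≤ ‖f z / z‖ ∧ ‖f z / z‖ ≤ M := by
  have hne : ∀ ζ : ℂ, ‖ζ‖ = r → ζ ≠ 0 := fun ζ hζ => norm_pos_iff.1 (hζ ▸ hr0)
  have hint := intervalIntegrable_majorant hα1 hr0 hr1
  have hI : ‖(r : ℂ) * Complex.I‖ = r := by simp [abs_of_pos hr0]
  have hI' : ‖-((r : ℂ) * Complex.I)‖ = r := by rw [norm_neg, hI]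
  have hre : ∀ ζ : ℂ, ‖ζ‖ = r → |∫ s in (0 : ℝ)..1, reIntegrand α ζ s| ≤
      ∫ s in (0 : ℝ)..1, majorant α r s := by
    intro ζ hζ
    rw [← Real.norm_eq_abs]
    refine intervalIntegral.norm_integral_le_of_norm_le zero_le_one
      (Filter.Eventually.of_forall fun s hs => ?_) hint
    subst hζ
    exact abs_reIntegrand_le hα1 hr1 (Set.Ioc_subset_Icc_self hs)
  refine ⟨Real.exp (-∫ s in (0 : ℝ)..1, majorant α r s),
    Real.exp (∫ s in (0 : ℝ)..1, majorant α r s), ⟨⟨r * Complex.I, hI, ?_⟩, ?_⟩,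
    ⟨⟨-(r * Complex.I), hI', ?_⟩, ?_⟩, ?_⟩
  · simp only
    rw [norm_exp_boothPrimitive hα1 (hne _ hI) (hI.trans_lt hr1), ← intervalIntegral.integral_neg]
    congr 1
    refine intervalIntegral.integral_congr fun s hs => ?_
    rw [Set.uIcc_of_le zero_le_one] at hs
    exact reIntegrand_I α hr0.le hr1 hs
  · rintro _ ⟨ζ, hζ, rfl⟩
    simp only
    rw [norm_exp_boothPrimitive hα1 (hne _ hζ) (hζ.trans_lt hr1)]
    exact Real.exp_le_exp.2 (abs_le.1 (hre ζ hζ)).1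
  · simp only
    rw [norm_exp_boothPrimitive hα1 (hne _ hI') (hI'.trans_lt hr1)]
    congr 1
    refine intervalIntegral.integral_congr fun s hs => ?_
    rw [Set.uIcc_of_le zero_le_one] at hs
    exact reIntegrand_neg_I α hr0.le hr1 hs
  · rintro _ ⟨ζ, hζ, rfl⟩
    simp only
    rw [norm_exp_boothPrimitive hα1 (hne _ hζ) (hζ.trans_lt hr1)]
    exact Real.exp_le_exp.2 (abs_le.1 (hre ζ hζ)).2
  · intro z hz
    have hz1 : ‖z‖ < 1 := hz.trans_lt hr1
    have hfz : 0 < ‖f z / z‖ :=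
      norm_pos_iff.2 (div_ne_zero (hf.2.1 z (mem_ball_zero_iff.2 hz1) (hne z hz)) (hne z hz))
    have h := abs_log_norm_div_le hα0 hα1 hf (hne z hz) hz1
    rw [hz, abs_le, Real.le_log_iff_exp_le hfz, Real.log_le_iff_le_exp hfz] at h
    exact h
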